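/- Let $X$ be a Peano continuum (a nonempty, connected, locally connected, compact metrizable space). Let a polyhedral expansion of $X$ be given, that is, an inverse sequence $X_0\leftarrow X_1\leftarrow X_2\leftarrow\cdots$ of compact polyhedra and continuous maps, together with projections $\pi_i\colon X\to X_i$ that exhibit $X$ as its inverse limit. Let $E_0\leftarrow E_1\leftarrow E_2\leftarrow\cdots$ be an inverse sequence of covering projections over $X$, that is, an inverse sequence of spaces and continuous maps together with surjective covering maps $p_n\colon E_n\to X$ that commute with the bonding maps of the $E_n$. Then there is an inverse sequence of covering maps over the given expansion, that is, an inverse sequence $F_0\leftarrow F_1\leftarrow F_2\leftarrow\cdots$ together with surjective covering maps $q_i\colon F_i\to X_i$ that commute with the bonding maps of the $F_i$ and of the $X_i$, such that: 1. for some strictly increasing sequence of indices $m_0<m_1<m_2<\cdots$, the inverse sequence $(E_n,p_n)$ of coverings of $X$ is homeomorphic to the pull-back of $(F_{m_n},q_{m_n})$ along $(\pi_{m_n})$: there are homeomorphisms $E_n\cong\{(x,z)\in X\times F_{m_n} : \pi_{m_n}(x)=q_{m_n}(z)\}$ over $X$ that commute with the bonding maps; 2. consequently, the inverse limits are homeomorphic: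 there is a homeomorphism $\varprojlim E_n\cong\varprojlim F_i$ that commutes with the limit projections $\varprojlim E_n\to X$ and $\varprojlim F_i\to\varprojlim X_i=X$. Moreover, if all $E_n$ are connected, then $F_i$ is connected for every $i$ for which $X_i$ is connected. -/

import Mathlib

universe u

namespace InverseLimitCoverings

/-- A Peano continuum: a nonempty connected, locally connected, compact metrizable space. -/
structure IsPeanoContinuum (X : Type u) [TopologicalSpace X] : Prop where
  compact : CompactSpace X
  connected : ConnectedSpace X
  locallyConnected : LocallyConnectedSpace X
  metrizable : TopologicalSpace.MetrizableSpace X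

/-- A compact polyhedron: a space homeomorphic to the underlying space of a finite
simplicial complex in some Euclidean space. -/
def IsCompactPolyhedron (Y : Type u) [TopologicalSpace Y] : Prop :=
  ∃ (N : ℕ) (K : Geometry.SimplicialComplex ℝ (EuclideanSpace ℝ (Fin N))),
    K.faces.Finite ∧ Nonempty (Y ≃ₜ K.space)

/-- An inverse sequence `Y₀ ← Y₁ ← Y₂ ← ⋯` of topological spaces and continuous maps;
`map h : Y j → Y i`, for `h : i ≤ j`, is the composite of the bonding maps. -/
structure InverseSequence : Type (u + 1) where
  obj : ℕ → Type u
  [top : ∀ i, TopologicalSpace (obj i)]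
  map : ∀ {i j : ℕ}, i ≤ j → obj j → obj i
  continuous_map : ∀ {i j : ℕ} (h : i ≤ j), Continuous (map h)
  map_self : ∀ (i : ℕ) (y : obj i), map (le_refl i) y = y
  map_map : ∀ {i j k : ℕ} (h : i ≤ j) (h' : j ≤ k) (y : obj k),
    map h (map h' y) = map (h.trans h') y

attribute [instance] InverseSequence.top

namespace InverseSequence

/-- The inverse limit: the space of all threads, as a subspace of the product. -/
def limit (Y : InverseSequence.{u}) : Type u :=
  {y : ∀ i, Y.obj i // ∀ (i j : ℕ) (h : i ≤ j), Y.map h (y j) = y i}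

instance (Y : InverseSequence.{u}) : TopologicalSpace Y.limit :=
  inferInstanceAs (TopologicalSpace
    {y : ∀ i, Y.obj i // ∀ (i j : ℕ) (h : i ≤ j), Y.map h (y j) = y i})

/-- The constant sequence `X = X = X = ⋯`. -/
def const (X : Type u) [TopologicalSpace X] : InverseSequence.{u} where
  obj _ := X
  map := fun _ x => x
  continuous_map _ := continuous_id
  map_self _ _ := rfl
  map_map _ _ _ := rfl

/-- The subsequence `Y (m 0) ← Y (m 1) ← ⋯`. -/
def subsequence (Y : InverseSequence.{u}) (m : ℕ → ℕ) (hm : StrictMono m) :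
    InverseSequence.{u} where
  obj n := Y.obj (m n)
  map h := Y.map (hm.monotone h)
  continuous_map h := Y.continuous_map _
  map_self n := Y.map_self (m n)
  map_map _ _ := Y.map_map _ _

end InverseSequence

open InverseSequence

/-- A compatible family of continuous maps from `X` to the terms of an inverse sequence. -/
structure Cone (X : Type u) [TopologicalSpace X] (Y : InverseSequence.{u}) where
  app : ∀ i, X → Y.obj i
  continuous_app : ∀ i, Continuous (app i)
  comm : ∀ {i j : ℕ} (h : i ≤ j) (x : X), Y.map h (app j x) = app i x

namespace Cone

variable {X : Type u} [TopologicalSpace X] {Y : InverseSequence.{u}}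

/-- The induced map to the inverse limit. -/
def toLimit (c : Cone X Y) (x : X) : Y.limit :=
  ⟨fun i => c.app i x, fun _ _ h => c.comm h x⟩

/-- `X`, with the given maps, is the inverse limit of the sequence. -/
def IsLimit (c : Cone X Y) : Prop := IsHomeomorph c.toLimit

/-- Restriction of a compatible family to a subsequence. -/
def subsequence (c : Cone X Y) (m : ℕ → ℕ) (hm : StrictMono m) :
    Cone X (Y.subsequence m hm) where
  app n := c.app (m n)
  continuous_app n := c.continuous_app (m n)
  comm h := c.comm (hm.monotone h)

end Cone

/-- A polyhedral expansion of `X`: an inverse sequence of compact polyhedra together with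
projections from `X` that exhibit `X` as its inverse limit. -/
structure PolyhedralExpansion (X : Type u) [TopologicalSpace X] where
  seq : InverseSequence.{u}
  polyhedron : ∀ i, IsCompactPolyhedron (seq.obj i)
  cone : Cone X seq
  isLimit : cone.IsLimit

/-- A commutative ladder of spaces and continuous maps over the inverse sequence `Y`:
an inverse sequence `total` with a level map `proj i : total i → Y i`. -/
structure SequenceOver (Y : InverseSequence.{u}) : Type (u + 1) where
  total : InverseSequence.{u}
  proj : ∀ i, total.obj i → Y.obj i
  continuous_proj : ∀ i, Continuous (proj i)
  comm : ∀ {i j : ℕ} (h : i ≤ j) (z : total.obj j),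
    Y.map h (proj j z) = proj i (total.map h z)

namespace SequenceOver

variable {X : Type u} [TopologicalSpace X] {Y : InverseSequence.{u}}

/-- All the level maps are (surjective) covering maps. -/
def IsCovering (F : SequenceOver Y) : Prop :=
  ∀ i, IsCoveringMap (F.proj i) ∧ Function.Surjective (F.proj i)

/-- The part of the ladder that lies over a subsequence. -/
def subsequence (F : SequenceOver Y) (m : ℕ → ℕ) (hm : StrictMono m) :
    SequenceOver (Y.subsequence m hm) where
  total := F.total.subsequence m hm
  proj n := F.proj (m n)
  continuous_proj n := F.continuous_proj (m n)
  comm h := F.comm (hm.monotone h)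

/-- The pull-back of a ladder over `Y` along a compatible family `X → Y i`: the levels are
the fibre products `{(x, z) | c i x = proj i z}` with the projection to `X`, and the
bonding maps are `(x, z) ↦ (x, map z)`. -/
def pullback (F : SequenceOver Y) (c : Cone X Y) : SequenceOver (const X) where
  total :=
    { obj := fun i => {w : X × F.total.obj i // c.app i w.1 = F.proj i w.2}
      map := fun {i j} h w => ⟨(w.1.1, F.total.map h w.1.2), by
        rw [← c.comm h, w.2, F.comm h]⟩
      continuous_map := fun h => by
        have := F.total.continuous_map h
        exact Continuous.subtype_mk (by fun_prop) _
      map_self := fun i w => Subtype.ext (Prod.ext rfl (F.total.map_self i _))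
      map_map := fun h h' w => Subtype.ext (Prod.ext rfl (F.total.map_map h h' _)) }
  proj i w := w.1.1
  continuous_proj i := continuous_fst.comp continuous_subtype_val
  comm _ _ := rfl

/-- Two ladders over the same sequence are homeomorphic: there are homeomorphisms of all
the levels that commute with the bonding maps and with the maps to the base. -/
def Homeomorphic (E F : SequenceOver Y) : Prop :=
  ∃ φ : ∀ i, E.total.obj i ≃ₜ F.total.obj i,
    (∀ i z, F.proj i (φ i z) = E.proj i z) ∧
    ∀ (i j : ℕ) (h : i ≤ j) (z : E.total.obj j),
      φ i (E.total.map h z) = F.total.map h (φ j z)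

/-- The map of inverse limits induced by the level maps. -/
def limitProj (F : SequenceOver Y) (z : F.total.limit) : Y.limit :=
  ⟨fun i => F.proj i (z.1 i), fun i j h => by rw [F.comm h, z.2 i j h]⟩

/-- The limit projection of a ladder over the constant sequence `X`, as a map to `X`. -/
def limitProjConst (E : SequenceOver (const X)) (z : E.total.limit) : X :=
  E.proj 0 (z.1 0)

end SequenceOver

end InverseLimitCoverings

open InverseLimitCoverings

/-!
Coverings of the limit `X` of an inverse sequence of compact Hausdorff spaces `Y i` are described by
combinatorial data which involve only finitely many non-emptiness conditions, and such data live
already over a late term.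

Choose a finite cover of `X` by small connected sets `U b` such that every union of two intersecting
members is evenly covered by `p : E → X`. Over connected sets a comparison of two trivializations
is a single map of the discrete fibre, so the transition functions on `U b ∩ U b'` are *constant*
(`Bundle.Trivialization.exists_eq_comp_snd`). Compactness
(`Cone.IsLimit.eventually_preimage_eq_empty`) yields an open cover `W b` of a late term `Y j` whose
members pull back into the `U b` and whose double and triple intersections are nonempty only if
those of the `U b` are (`Cone.IsLimit.exists_refined_cover`). The constants then satisfy the cocycle
condition over `Y j` because they do so at points of `X`, and they glue to a covering of `Y j` that
pulls back to `E`. This is the notion of a `Presentation`. A map `E' → E` of coverings over `X` is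
given in connected charts by constant maps of the fibres as well, so for a presentation of `E'`
fine enough to refine that of `E` it descends to the glued coverings by the same principle
(`Presentation.exists_refinement`, `Presentation.Refinement.totalMap`).

Iterating this along the sequence `E n`, starting from the identity covering of `X` over the term
`Y 0`, gives coverings of a subsequence of terms (`Cone.IsLimit.exists_descent`); over the
remaining terms they are pulled back from the preceding member of the subsequence
(`SequenceOver.fill`). The limits agree because `X` is the limit of the `Y i`
(`SequenceOver.exists_limit_homeomorph`). Finally, a connected covering of `X` maps onto a whole
fibre of the corresponding covering of `Y i`, and each component of the latter meets this fibre when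
`Y i` is connected, polyhedra being locally connected (`connectedSpace_of_fiber_subset_range`).
-/

namespace InverseLimitCoverings

open Set Filter Topology Bundle

/-! ### Compact polyhedra -/

theorem IsCompactPolyhedron.compactSpace {Y : Type u} [TopologicalSpace Y]
    (hY : IsCompactPolyhedron Y) : CompactSpace Y := by
  obtain ⟨N, K, hK, ⟨e⟩⟩ := hY
  have : IsCompact K.space :=
    hK.isCompact_biUnion fun s _ => s.finite_toSet.isCompact_convexHull ℝ
  have := isCompact_iff_compactSpace.mp this
  exact e.symm.compactSpace

theorem IsCompactPolyhedron.t2Space {Y : Type u} [TopologicalSpace Y]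
    (hY : IsCompactPolyhedron Y) : T2Space Y := by
  obtain ⟨N, K, hK, ⟨e⟩⟩ := hY
  exact e.symm.t2Space

/-- Around each of its points the space of a finite simplicial complex is a union of convex sets
containing that point. -/
theorem locallyConnectedSpace_simplicialComplex_space {V : Type*} [NormedAddCommGroup V]
    [NormedSpace ℝ V] (K : Geometry.SimplicialComplex ℝ V) (hK : K.faces.Finite) :
    LocallyConnectedSpace K.space := by
  refine locallyConnectedSpace_of_connected_bases
    (fun x r => Metric.ball x r)
    (fun x r => 0 < r ∧ ∀ s ∈ K.faces, ∀ y ∈ convexHull ℝ (s : Set V),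
      dist y x.1 < r → x.1 ∈ convexHull ℝ (s : Set V)) ?_ ?_
  · intro x
    -- the ball must be small enough to miss the finitely many simplices that avoid `x`
    obtain ⟨r₀, hr₀, h₀⟩ : ∃ r₀ > 0, ∀ s ∈ K.faces, ∀ y ∈ convexHull ℝ (s : Set V),
        dist y x.1 < r₀ → x.1 ∈ convexHull ℝ (s : Set V) := by
      have : ∀ᶠ y in 𝓝 x.1, ∀ s ∈ K.faces,
          y ∈ convexHull ℝ (s : Set V) → x.1 ∈ convexHull ℝ (s : Set V) := by
        refine (eventually_all_finite hK).mpr fun s _ => ?_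
        by_cases hx : x.1 ∈ convexHull ℝ (s : Set V)
        · exact Eventually.of_forall fun _ _ => hx
        · filter_upwards [(s.finite_toSet.isCompact_convexHull ℝ).isClosed.isOpen_compl.mem_nhds hx]
            with y hy hy'
          exact absurd hy' hy
      obtain ⟨r, hr, h⟩ := Metric.eventually_nhds_iff.mp this
      exact ⟨r, hr, fun s hs y hy hd => h hd s hs hy⟩
    refine Metric.nhds_basis_ball.to_hasBasis (fun r hr => ?_) fun r hr => ⟨r, hr.1, subset_rfl⟩
    exact ⟨min r r₀, ⟨lt_min hr hr₀, fun s hs y hy hd => h₀ s hs y hy (hd.trans_le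
      (min_le_right _ _))⟩, Metric.ball_subset_ball (min_le_left _ _)⟩
  · rintro x r ⟨hr, h⟩
    refine isPreconnected_of_forall x fun y hy => ?_
    obtain ⟨s, hs, hys⟩ := Geometry.SimplicialComplex.mem_space_iff.mp y.2
    have hxs := h s hs y.1 hys hy
    have hC : IsPreconnected (convexHull ℝ (s : Set V) ∩ Metric.ball x.1 r) :=
      ((convex_convexHull ℝ _).inter (convex_ball _ _)).isPreconnected
    have hCK : convexHull ℝ (s : Set V) ∩ Metric.ball x.1 r ⊆ K.space :=
      inter_subset_left.trans (Geometry.SimplicialComplex.convexHull_subset_space hs)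
    refine ⟨(↑) ⁻¹' (convexHull ℝ (s : Set V) ∩ Metric.ball x.1 r), fun z hz => hz.2,
      ⟨hxs, Metric.mem_ball_self hr⟩, ⟨hys, hy⟩, ?_⟩
    rw [← IsInducing.subtypeVal.isPreconnected_image, Subtype.image_preimage_coe,
      inter_eq_self_of_subset_right hCK]
    exact hC

theorem IsCompactPolyhedron.locallyConnectedSpace {Y : Type u} [TopologicalSpace Y]
    (hY : IsCompactPolyhedron Y) : LocallyConnectedSpace Y := by
  obtain ⟨N, K, hK, ⟨e⟩⟩ := hY
  have := locallyConnectedSpace_simplicialComplex_space K hK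
  exact e.locallyConnectedSpace

/-! ### Limits of inverse sequences of compact Hausdorff spaces -/

section Limits

variable {X : Type u} [TopologicalSpace X] {Y : InverseSequence.{u}} {c : Cone X Y}

/-- Preimages of open sets from arbitrarily late terms form a basis of the inverse limit. -/
theorem Cone.IsLimit.exists_preimage_subset (hc : c.IsLimit) {x : X} {U : Set X} (hU : U ∈ 𝓝 x)
    (i₀ : ℕ) : ∃ i, i₀ ≤ i ∧ ∃ O ∈ 𝓝 (c.app i x), c.app i ⁻¹' O ⊆ U := by
  have hind : IsInducing fun (x : X) (i : ℕ) => c.app i x :=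
    IsInducing.subtypeVal.comp hc.isInducing
  rw [hind.nhds_eq_comap, mem_comap] at hU
  obtain ⟨t, ht, htU⟩ := hU
  rw [nhds_pi, mem_pi'] at ht
  obtain ⟨I, s, hs, hst⟩ := ht
  have hI : ∀ a : I, a.1 ≤ max i₀ (I.sup id) := fun a =>
    (Finset.le_sup (f := id) a.2).trans (le_max_right _ _)
  refine ⟨max i₀ (I.sup id), le_max_left _ _, ⋂ a : I, Y.map (hI a) ⁻¹' s a.1,
    iInter_mem.mpr fun a => ?_, fun z hz => htU (hst fun a ha => ?_)⟩
  · apply (Y.continuous_map (hI a)).continuousAt.preimage_mem_nhds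
    rw [c.comm]
    exact hs a
  · have := mem_iInter.mp hz ⟨a, ha⟩
    rwa [mem_preimage, c.comm] at this

/-- A closed subset of a term that misses the image of the limit misses the image of all late
terms. -/
theorem Cone.IsLimit.eventually_preimage_eq_empty [Nonempty X] [∀ i, CompactSpace (Y.obj i)]
    [∀ i, T2Space (Y.obj i)] (hc : c.IsLimit) {i : ℕ} {C : Set (Y.obj i)} (hC : IsClosed C)
    (hempty : c.app i ⁻¹' C = ∅) : ∀ᶠ j in atTop, ∀ h : i ≤ j, Y.map h ⁻¹' C = ∅ := by
  by_contra hcon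
  have hne : ∀ j, ∀ h : i ≤ j, ∃ y, Y.map h y ∈ C := by
    intro j h
    by_contra! hy
    refine hcon (eventually_atTop.mpr ⟨j, fun k hk h' => eq_empty_of_forall_notMem fun y hyC =>
      hy (Y.map hk y) ?_⟩)
    rwa [Y.map_map]
  obtain ⟨x₀⟩ := ‹Nonempty X›
  let K : ℕ → Set (∀ i, Y.obj i) := fun j =>
    {y | ∀ (a b : ℕ) (h : a ≤ b), b ≤ j → Y.map h (y b) = y a} ∩ {y | y i ∈ C}
  have hKcl : ∀ j, IsClosed (K j) := by
    intro j
    refine IsClosed.inter ?_ (hC.preimage (continuous_apply i))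
    simp only [ofPred_forall]
    exact isClosed_iInter fun a => isClosed_iInter fun b => isClosed_iInter fun h =>
      isClosed_iInter fun _ => isClosed_eq ((Y.continuous_map h).comp (continuous_apply b))
        (continuous_apply a)
  obtain ⟨y, hy⟩ := IsCompact.nonempty_iInter_of_sequence_nonempty_isCompact_isClosed K
    (fun j y hy => ⟨fun a b h hb => hy.1 a b h (hb.trans (Nat.le_succ j)), hy.2⟩)
    (fun j => by
      obtain ⟨z, hz⟩ := hne (max i j) (le_max_left _ _)
      refine ⟨fun a => if h : a ≤ max i j then Y.map h z else c.app a x₀, ?_, ?_⟩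
      · intro a b h hb
        have hb' : b ≤ max i j := hb.trans (le_max_right _ _)
        simp only [hb', h.trans hb', dif_pos, Y.map_map]
      · simpa using hz)
    (hKcl 0).isCompact hKcl
  rw [mem_iInter] at hy
  obtain ⟨x, hx⟩ := hc.surjective ⟨y, fun a b h => (hy b).1 a b h le_rfl⟩
  have hxi : c.app i x = y i := congrFun (congrArg Subtype.val hx) i
  exact eq_empty_iff_forall_notMem.mp hempty x (by rw [mem_preimage, hxi]; exact (hy 0).2)

/-- Over a late term of the expansion there is an open cover `W` whose nerve (up to dimension two)
is dominated by that of a finite family `U` of connected subsets of the limit. Each union of two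
intersecting members of `U` is contained in a member of a prescribed open cover `V` of the limit,
and `W` refines a prescribed family `W₀` of open sets of an earlier term. -/
theorem Cone.IsLimit.exists_refined_cover [CompactSpace X] [ConnectedSpace X]
    [LocallyConnectedSpace X] [TopologicalSpace.MetrizableSpace X] [∀ i, CompactSpace (Y.obj i)]
    [∀ i, T2Space (Y.obj i)] (hc : c.IsLimit) {ι : Type*} {V : ι → Set X}
    (hV : ∀ k, IsOpen (V k)) (hVc : ∀ x, ∃ k, x ∈ V k) {i₀ : ℕ} {A : Type*}
    {W₀ : A → Set (Y.obj i₀)} (hW₀ : ∀ a, IsOpen (W₀ a)) (hW₀c : ∀ x, ∃ a, c.app i₀ x ∈ W₀ a) :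
    ∃ (j : ℕ) (_ : i₀ < j) (hj : i₀ ≤ j) (B : Type u) (U : B → Set X) (W : B → Set (Y.obj j))
      (r : B → A),
      (∀ b, IsConnected (U b)) ∧
      (∀ b b', (U b ∩ U b').Nonempty → ∃ k, U b ⊆ V k ∧ U b' ⊆ V k) ∧
      (∀ b, IsOpen (W b)) ∧ (∀ y, ∃ b, y ∈ W b) ∧
      (∀ b x, c.app j x ∈ W b → x ∈ U b) ∧
      (∀ b b' b'', (W b ∩ W b' ∩ W b'').Nonempty → (U b ∩ U b' ∩ U b'').Nonempty) ∧
      (∀ b, ∀ y ∈ W b, Y.map hj y ∈ W₀ (r b)) ∧ (∀ b, ∀ x ∈ U b, c.app i₀ x ∈ W₀ (r b)) := by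
  let := TopologicalSpace.metrizableSpaceMetric X
  obtain ⟨δ, hδ, hball⟩ := lebesgue_number_lemma_of_metric (isCompact_univ (X := X)) hV
    (fun x _ => mem_iUnion.mpr (hVc x))
  choose a ha using hW₀c
  let N : X → Set X := fun x => Metric.ball x (δ / 4) ∩ c.app i₀ ⁻¹' W₀ (a x)
  have hNo : ∀ x, IsOpen (N x) := fun x =>
    Metric.isOpen_ball.inter ((hW₀ _).preimage (c.continuous_app _))
  have hNx : ∀ x, x ∈ N x := fun x => ⟨Metric.mem_ball_self (by positivity), ha x⟩
  let U₀ : X → Set X := fun x => connectedComponentIn (N x) x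
  have hU₀ : ∀ x, U₀ x ∈ 𝓝 x := fun x =>
    (hNo x).connectedComponentIn.mem_nhds (mem_connectedComponentIn (hNx x))
  have hU₀N : ∀ x, U₀ x ⊆ N x := fun x => connectedComponentIn_subset _ _
  choose i hi O hO hOU using fun x => hc.exists_preimage_subset (hU₀ x) i₀
  choose C hC hCcl hCO using fun x => exists_mem_nhds_isClosed_subset
    (inter_mem (hO x) (((hW₀ (a x)).preimage (Y.continuous_map (hi x))).mem_nhds
      (by rw [mem_preimage, c.comm]; exact ha x)))
  obtain ⟨t, ht⟩ := CompactSpace.elim_nhds_subcover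
    (fun x => c.app (i x) ⁻¹' interior (C x)) fun x =>
      (c.continuous_app _).continuousAt.preimage_mem_nhds (interior_mem_nhds.mpr (hC x))
  let M := t.sup i
  have hM : ∀ b : t, i b ≤ M := fun b => Finset.le_sup (f := i) b.2
  -- the closed sets and the open sets, brought to the common term `M`
  let C' : t → Set (Y.obj M) := fun b => Y.map (hM b) ⁻¹' C b
  let O' : t → Set (Y.obj M) := fun b => Y.map (hM b) ⁻¹' interior (C b)
  have hC'cl : ∀ b, IsClosed (C' b) := fun b => (hCcl b).preimage (Y.continuous_map _)
  have hO'o : ∀ b, IsOpen (O' b) := fun b => isOpen_interior.preimage (Y.continuous_map _)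
  have hO'C' : ∀ b, O' b ⊆ C' b := fun b => preimage_mono interior_subset
  have hC'U : ∀ b x, c.app M x ∈ C' b → x ∈ U₀ b := by
    intro b x hx
    have hx' : Y.map (hM b) (c.app M x) ∈ C b := hx
    rw [c.comm] at hx'
    exact hOU b (hCO b hx').1
  have hcov : c.app M ⁻¹' (⋃ b, O' b)ᶜ = ∅ := by
    refine eq_empty_of_forall_notMem fun x hx => hx ?_
    have hxt : x ∈ ⋃ x ∈ t, c.app (i x) ⁻¹' interior (C x) := ht ▸ mem_univ x
    simp only [mem_iUnion, exists_prop] at hxt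
    obtain ⟨b, hb, hxb⟩ := hxt
    refine mem_iUnion.mpr ⟨⟨b, hb⟩, ?_⟩
    rw [mem_preimage, c.comm]
    exact hxb
  have hev₁ := hc.eventually_preimage_eq_empty (isOpen_iUnion hO'o).isClosed_compl hcov
  have hev₂ : ∀ᶠ j in atTop, ∀ b b' b'' : t, ∀ h : M ≤ j, U₀ b ∩ U₀ b' ∩ U₀ b'' = ∅ →
      Y.map h ⁻¹' (C' b ∩ C' b' ∩ C' b'') = ∅ := by
    refine eventually_all.mpr fun b => eventually_all.mpr fun b' => eventually_all.mpr fun b'' => ?_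
    by_cases hU : U₀ b ∩ U₀ b' ∩ U₀ b'' = ∅
    · have := hc.eventually_preimage_eq_empty (((hC'cl b).inter (hC'cl b')).inter (hC'cl b''))
        (eq_empty_of_forall_notMem fun x hx => eq_empty_iff_forall_notMem.mp hU x
          ⟨⟨hC'U b x hx.1.1, hC'U b' x hx.1.2⟩, hC'U b'' x hx.2⟩)
      filter_upwards [this] with j hj h _ using hj h
    · exact Eventually.of_forall fun _ _ h => absurd h hU
  obtain ⟨j, ⟨⟨hj₁, hj₂⟩, hMj⟩, hij⟩ :=
    (((hev₁.and hev₂).and (eventually_ge_atTop M)).and (eventually_gt_atTop i₀)).exists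
  refine ⟨j, hij, hij.le, t, fun b => U₀ b, fun b => Y.map hMj ⁻¹' O' b, fun b => a b,
    fun b => isConnected_connectedComponentIn_iff.mpr (hNx b), ?_, fun b => (hO'o b).preimage
      (Y.continuous_map _), ?_, ?_, ?_, ?_, fun b x hx => (hU₀N b hx).2⟩
  · rintro b b' ⟨x, hx, hx'⟩
    obtain ⟨k, hk⟩ := hball b (mem_univ _)
    have h₁ := (hU₀N b hx).1
    have h₂ := (hU₀N b' hx').1
    rw [Metric.mem_ball] at h₁ h₂
    refine ⟨k, fun z hz => hk ?_, fun z hz => hk ?_⟩ <;> have h₃ := (hU₀N _ hz).1 <;>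
      rw [Metric.mem_ball] at h₃ ⊢
    · linarith
    · have := dist_triangle z b' x
      have := dist_triangle z x b
      rw [dist_comm x b'] at *
      linarith
  · intro y
    by_contra! hy
    refine eq_empty_iff_forall_notMem.mp (hj₁ hMj) y fun hyO => ?_
    obtain ⟨b, hb⟩ := mem_iUnion.mp hyO
    exact hy b hb
  · intro b x hx
    have hx' : Y.map hMj (c.app j x) ∈ O' b := hx
    rw [c.comm] at hx'
    exact hC'U b x (hO'C' b hx')
  · rintro b b' b'' ⟨y, ⟨hy, hy'⟩, hy''⟩
    rw [nonempty_iff_ne_empty]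
    intro hU
    exact eq_empty_iff_forall_notMem.mp (hj₂ b b' b'' hMj hU) y
      ⟨⟨hO'C' _ hy, hO'C' _ hy'⟩, hO'C' _ hy''⟩
  · intro b y hy
    have := (hCO b (interior_subset hy)).2
    rwa [mem_preimage, Y.map_map, Y.map_map] at this

end Limits

/-! ### Trivializations with discrete fibre -/

section Trivializations

variable {X E S : Type*} [TopologicalSpace X] [TopologicalSpace E] [TopologicalSpace S] {p : E → X}

theorem continuousOn_trivialization_snd (t : Trivialization S p) {U : Set X}
    (hUt : U ⊆ t.baseSet) : ContinuousOn (fun e => (t e).2) (p ⁻¹' U) :=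
  continuous_snd.comp_continuousOn (t.continuousOn_toFun.mono (t.preimage_subset_source hUt))

theorem _root_.Bundle.Trivialization.exists_proj_eq_and_snd_eq (t : Trivialization S p) {x : X}
    (hx : x ∈ t.baseSet) (s : S) : ∃ e, p e = x ∧ (t e).2 = s :=
  ⟨t.toOpenPartialHomeomorph.symm (x, s), t.proj_symm_apply' hx,
    by rw [t.apply_symm_apply' hx]⟩

/-- Over a connected trivializing set, a locally constant function on the total space depends on
the sheet only. -/
theorem _root_.Bundle.Trivialization.exists_eq_comp_snd (t : Trivialization S p) {U : Set X}
    (hU : IsConnected U) (hUt : U ⊆ t.baseSet) {D : Type*} [TopologicalSpace D]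
    [DiscreteTopology D] {σ : E → D} (hσ : ContinuousOn σ (p ⁻¹' U)) :
    ∃ k : S → D, ∀ e, p e ∈ U → σ e = k (t e).2 := by
  obtain ⟨x₀, hx₀⟩ := hU.nonempty
  refine ⟨fun s => σ (t.toOpenPartialHomeomorph.symm (x₀, s)), fun e he => ?_⟩
  have hc : ContinuousOn (fun x => σ (t.toOpenPartialHomeomorph.symm (x, (t e).2))) U :=
    hσ.comp (t.continuousOn_symm_prodMk_left.mono hUt) fun x hx => by
      rw [mem_preimage, t.proj_symm_apply' (hUt hx)]
      exact hx
  have := hU.isPreconnected.constant hc he hx₀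
  rwa [t.symm_apply_mk_proj (t.mem_source.mpr (hUt he))] at this

/-- Over a connected base, all local trivializations of a covering can be given the same fibre. -/
theorem _root_.IsCoveringMap.exists_trivialization_fiber [PreconnectedSpace X]
    (hp : IsCoveringMap p) (hsurj : Function.Surjective p) (x₀ x : X) :
    ∃ t : Trivialization (p ⁻¹' {x₀}) p, x ∈ t.baseSet := by
  have hne : ∀ x, Nonempty (p ⁻¹' {x}) := fun x => (hsurj x).elim fun e he => ⟨⟨e, he⟩⟩
  let A : Set X := {x | ∃ t : Trivialization (p ⁻¹' {x₀}) p, x ∈ t.baseSet}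
  have hA : IsClopen A := by
    refine ⟨⟨isOpen_iff_mem_nhds.mpr fun y hy => ?_⟩, isOpen_iff_mem_nhds.mpr ?_⟩
    · have hty := (hp y).mem_toTrivialization_baseSet
      filter_upwards [(hp y).toTrivialization.open_baseSet.mem_nhds hty]
      rintro z hz ⟨t, ht⟩
      exact hy ⟨(hp y).toTrivialization.transFiberHomeomorph
        (((hp y).toTrivialization.preimageSingletonHomeomorph hz).symm.trans
          (t.preimageSingletonHomeomorph ht)), hty⟩
    · rintro y ⟨t, ht⟩
      filter_upwards [t.open_baseSet.mem_nhds ht] with z hz using ⟨t, hz⟩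
  have hx : x ∈ A := by
    rw [hA.eq_univ ⟨x₀, _, (hp x₀).mem_toTrivialization_baseSet⟩]
    trivial
  exact hx

/-- The trivialization, with one sheet, of the identity map. -/
def idTrivialization (X : Type*) [TopologicalSpace X] :
    Trivialization PUnit.{u + 1} (fun x : X => x) where
  toOpenPartialHomeomorph := (Homeomorph.prodPUnit X).symm.toOpenPartialHomeomorph
  baseSet := univ
  open_baseSet := isOpen_univ
  source_eq := rfl
  target_eq := by simp
  proj_toFun _ _ := rfl

end Trivializations

/-! ### Coverings of the limit presented over a term -/

/-- A presentation, over the term `Y.obj level`, of a covering `p : E → X` of the limit `X`: an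
open cover `base` of the term, subsets `dom` of `X` with the same index set `Chart` over which `p`
is trivial, and *constant* transition functions `trans`. The pull-back of `base b` lies in
`dom b`, and three members of `base` only meet if the corresponding members of `dom` do. -/
structure Presentation {X : Type u} [TopologicalSpace X] {Y : InverseSequence.{u}} (c : Cone X Y)
    {E : Type u} [TopologicalSpace E] (p : E → X) : Type (u + 1) where
  level : ℕ
  Fiber : Type u
  [topFiber : TopologicalSpace Fiber]
  [discreteFiber : DiscreteTopology Fiber]
  Chart : Type u
  dom : Chart → Set X
  base : Chart → Set (Y.obj level)
  isOpen_base : ∀ b, IsOpen (base b)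
  exists_mem_base : ∀ y, ∃ b, y ∈ base b
  mem_dom : ∀ b x, c.app level x ∈ base b → x ∈ dom b
  dom_nonempty : ∀ b b' b'', (base b ∩ base b' ∩ base b'').Nonempty →
    (dom b ∩ dom b' ∩ dom b'').Nonempty
  triv : Chart → Trivialization Fiber p
  dom_subset : ∀ b, dom b ⊆ (triv b).baseSet
  trans : Chart → Chart → Fiber → Fiber
  trans_apply : ∀ b b' e, p e ∈ dom b → p e ∈ dom b' →
    trans b b' (triv b e).2 = (triv b' e).2

namespace Presentation

attribute [instance] topFiber discreteFiber

variable {X : Type u} [TopologicalSpace X] {Y : InverseSequence.{u}} {c : Cone X Y}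
  {E : Type u} [TopologicalSpace E] {p : E → X}

/-- The gluing data over `Y.obj D.level` given by a presentation. Since the transition functions are
constant, the cocycle condition can be checked at points of `X`, where it holds because the
transition functions come from a covering. -/
noncomputable def core (D : Presentation c p) :
    FiberBundleCore D.Chart (Y.obj D.level) D.Fiber where
  baseSet := D.base
  isOpen_baseSet := D.isOpen_base
  indexAt y := (D.exists_mem_base y).choose
  mem_baseSet_at y := (D.exists_mem_base y).choose_spec
  coordChange b b' _ s := D.trans b b' s
  coordChange_self b y hy s := by
    obtain ⟨x, ⟨hx, -⟩, -⟩ := D.dom_nonempty b b b ⟨y, ⟨hy, hy⟩, hy⟩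
    obtain ⟨e, rfl, rfl⟩ := (D.triv b).exists_proj_eq_and_snd_eq (D.dom_subset b hx) s
    exact D.trans_apply b b e hx hx
  continuousOn_coordChange b b' :=
    (continuous_of_discreteTopology.comp continuous_snd).continuousOn
  coordChange_comp b b' b'' y hy s := by
    obtain ⟨x, ⟨hx, hx'⟩, hx''⟩ := D.dom_nonempty b b' b'' ⟨y, hy⟩
    obtain ⟨e, rfl, rfl⟩ := (D.triv b).exists_proj_eq_and_snd_eq (D.dom_subset b hx) s
    rw [D.trans_apply b b' e hx hx', D.trans_apply b' b'' e hx' hx'',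
      D.trans_apply b b'' e hx hx'']

/-- The total space of the covering of `Y.obj D.level` glued from a presentation. -/
abbrev Total (D : Presentation c p) : Type u := D.core.TotalSpace

/-- The glued covering. -/
noncomputable def proj (D : Presentation c p) : D.Total → Y.obj D.level := D.core.proj

theorem continuous_proj (D : Presentation c p) : Continuous D.proj := D.core.continuous_proj

theorem isCoveringMap_proj (D : Presentation c p) : IsCoveringMap D.proj :=
  FiberBundle.isCoveringMap (F := D.Fiber) (E := D.core.Fiber)

theorem surjective_proj [Nonempty X] (D : Presentation c p) (hp : Function.Surjective p) :
    Function.Surjective D.proj := by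
  obtain ⟨x⟩ := ‹Nonempty X›
  obtain ⟨e, -⟩ := hp x
  obtain ⟨b, -⟩ := D.exists_mem_base (c.app D.level x)
  have : Nonempty D.Fiber := ⟨(D.triv b e).2⟩
  exact FiberBundle.surjective_proj D.Fiber D.core.Fiber

/-- A map into the glued covering is continuous if it is so over the base and its fibre coordinate
is locally constant in each chart. -/
theorem continuous_of_charts (D : Presentation c p) {A : Type*} [TopologicalSpace A]
    {f : A → D.Total} (hf : Continuous fun a => (f a).1)
    (h : ∀ a b, (f a).1 ∈ D.base b →
      ∀ᶠ a' in 𝓝 a, D.trans (D.core.indexAt (f a').1) b (f a').2 =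
        D.trans (D.core.indexAt (f a).1) b (f a).2) : Continuous f := by
  refine continuous_iff_continuousAt.mpr fun a => ?_
  rw [FiberBundle.continuousAt_totalSpace]
  refine ⟨hf.continuousAt, ?_⟩
  have := h a _ (D.core.mem_baseSet_at (f a).1)
  exact continuousAt_const.congr (this.mono fun a' ha' => ha'.symm)

/-- The canonical map from the given covering of `X` to the glued covering. -/
noncomputable def toTotal (D : Presentation c p) (e : E) : D.Total :=
  ⟨c.app D.level (p e), (D.triv (D.core.indexAt (c.app D.level (p e))) e).2⟩

theorem mem_dom_indexAt (D : Presentation c p) (x : X) :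
    x ∈ D.dom (D.core.indexAt (c.app D.level x)) :=
  D.mem_dom _ _ (D.core.mem_baseSet_at _)

theorem eventually_triv_snd_eq (D : Presentation c p) (hp : Continuous p) {b : D.Chart} {e : E}
    (he : p e ∈ D.dom b) : ∀ᶠ e' in 𝓝 e, (D.triv b e').2 = (D.triv b e).2 := by
  have hbase := D.dom_subset b he
  have hc : ContinuousAt (fun e => (D.triv b e).2) e :=
    (continuousOn_trivialization_snd (D.triv b) subset_rfl).continuousAt
      (((D.triv b).open_baseSet.preimage hp).mem_nhds hbase)
  exact hc.eventually (discreteTopology_iff_forall_isOpen.mp inferInstance {_} |>.mem_nhds rfl)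

theorem continuous_toTotal (D : Presentation c p) (hp : Continuous p) :
    Continuous D.toTotal := by
  have hcp := (c.continuous_app D.level).comp hp
  refine D.continuous_of_charts hcp fun e b hb => ?_
  have hb' : c.app D.level (p e) ∈ D.base b := hb
  filter_upwards [hcp.continuousAt.preimage_mem_nhds ((D.isOpen_base b).mem_nhds hb'),
    D.eventually_triv_snd_eq hp (D.mem_dom b _ hb')] with e' he' heq
  have key : ∀ e', c.app D.level (p e') ∈ D.base b →
      D.trans (D.core.indexAt (D.toTotal e').1) b (D.toTotal e').2 = (D.triv b e').2 :=
    fun e' he' => D.trans_apply _ _ _ (D.mem_dom_indexAt _) (D.mem_dom b _ he')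
  rw [key e' he', key e hb', heq]

/-- The canonical map exhibits the given covering as the pull-back of the glued one. -/
theorem existsUnique_toTotal_eq (D : Presentation c p) (x : X) (z : D.Total)
    (h : c.app D.level x = D.proj z) : ∃! e, p e = x ∧ D.toTotal e = z := by
  obtain ⟨y, s⟩ := z
  obtain rfl : c.app D.level x = y := h
  have hx := D.dom_subset _ (D.mem_dom_indexAt x)
  obtain ⟨e, rfl, rfl⟩ := (D.triv _).exists_proj_eq_and_snd_eq hx s
  refine ⟨e, ⟨rfl, rfl⟩, fun e' he' => ?_⟩
  obtain ⟨he', he''⟩ := he'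
  unfold toTotal at he''
  rw [he'] at he''
  have hs : (D.triv (D.core.indexAt (c.app D.level (p e))) e').2 =
      (D.triv (D.core.indexAt (c.app D.level (p e))) e).2 :=
    eq_of_heq (TotalSpace.ext_iff.mp he'').2
  refine (D.triv _).injOn ((D.triv _).mem_source.mpr (he'.symm ▸ hx))
    ((D.triv _).mem_source.mpr hx) ?_
  change D.triv _ e' = D.triv _ e
  rw [← (D.triv _).mk_proj_snd' hx, ← (D.triv _).mk_proj_snd' (he'.symm ▸ hx), he', hs]

/-- The presentation of the identity covering over the initial term, with a single chart. -/
noncomputable def initial [Nonempty X] (c : Cone X Y) : Presentation c (fun x : X => x) where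
  level := 0
  Fiber := PUnit
  Chart := PUnit
  dom _ := univ
  base _ := univ
  isOpen_base _ := isOpen_univ
  exists_mem_base _ := ⟨⟨⟩, trivial⟩
  mem_dom _ _ _ := trivial
  dom_nonempty _ _ _ _ := ⟨Classical.arbitrary X, by simp⟩
  triv _ := idTrivialization X
  dom_subset _ := subset_rfl
  trans _ _ s := s
  trans_apply _ _ _ _ _ := rfl

variable {E' : Type u} [TopologicalSpace E'] {p' : E' → X}

/-- A presentation `D'` refines `D`, along a map `φ` of the presented coverings of `X`, if its
charts lie over charts of `D` and `φ` is given in these charts by *constant* maps of the fibres. -/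
structure Refinement (D' : Presentation c p') (D : Presentation c p) (φ : E' → E) where
  level_lt : D.level < D'.level
  chart : D'.Chart → D.Chart
  fiberMap : D'.Chart → D'.Fiber → D.Fiber
  mem_base : ∀ b, ∀ y ∈ D'.base b, Y.map level_lt.le y ∈ D.base (chart b)
  mem_dom : ∀ b, ∀ x ∈ D'.dom b, x ∈ D.dom (chart b)
  fiberMap_apply : ∀ b e, p' e ∈ D'.dom b →
    fiberMap b (D'.triv b e).2 = (D.triv (chart b) (φ e)).2

/-- Every covering `E'` of the limit has a presentation over a late term, which can be chosen to
refine a given presentation of a covering `E` along any map `E' → E` over `X`. -/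
theorem exists_refinement [CompactSpace X] [ConnectedSpace X] [LocallyConnectedSpace X]
    [TopologicalSpace.MetrizableSpace X] [∀ i, CompactSpace (Y.obj i)] [∀ i, T2Space (Y.obj i)]
    (hc : c.IsLimit) (D : Presentation c p) (hp' : IsCoveringMap p')
    (hsurj : Function.Surjective p') {φ : E' → E} (hφ : Continuous φ)
    (hpφ : ∀ e, p (φ e) = p' e) : ∃ D' : Presentation c p', Nonempty (Refinement D' D φ) := by
  obtain ⟨x₀⟩ : Nonempty X := inferInstance
  have hdisc : DiscreteTopology (p' ⁻¹' {x₀}) := (hp' x₀).1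
  choose t ht using hp'.exists_trivialization_fiber hsurj x₀
  obtain ⟨j, hlt, hle, B, U, W, r, hU, hUU, hWo, hWc, hWU, htriple, hWr, hUr⟩ :=
    hc.exists_refined_cover (fun x => (t x).open_baseSet) (fun x => ⟨x, ht x⟩) D.isOpen_base
      (fun x => D.exists_mem_base (c.app D.level x))
  have hUt : ∀ b, ∃ x, U b ⊆ (t x).baseSet := fun b =>
    (hUU b b (by simpa using (hU b).nonempty)).imp fun x hx => hx.1
  choose k hk using hUt
  have hg : ∀ b b', ∃ g : p' ⁻¹' {x₀} → p' ⁻¹' {x₀}, ∀ e, p' e ∈ U b → p' e ∈ U b' →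
      g (t (k b) e).2 = (t (k b') e).2 := by
    intro b b'
    by_cases hne : (U b ∩ U b').Nonempty
    · -- both charts are compared with a trivialization over a set containing both domains
      obtain ⟨x, hx, hx'⟩ := hUU b b' hne
      obtain ⟨g₁, hg₁⟩ := (t (k b)).exists_eq_comp_snd (hU b) (hk b)
        (continuousOn_trivialization_snd (t x) hx)
      obtain ⟨g₂, hg₂⟩ := (t x).exists_eq_comp_snd (hU b') hx'
        (continuousOn_trivialization_snd (t (k b')) (hk b'))
      exact ⟨g₂ ∘ g₁, fun e he he' => by rw [Function.comp_apply, ← hg₁ e he, ← hg₂ e he']⟩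
    · exact ⟨id, fun e he he' => absurd ⟨p' e, he, he'⟩ hne⟩
  choose g hg using hg
  have hUdom : ∀ b, ∀ x ∈ U b, x ∈ D.dom (r b) := fun b x hx => D.mem_dom _ _ (hUr b x hx)
  have hh : ∀ b, ∃ h : p' ⁻¹' {x₀} → D.Fiber, ∀ e, p' e ∈ U b →
      (D.triv (r b) (φ e)).2 = h (t (k b) e).2 := fun b =>
    (t (k b)).exists_eq_comp_snd (hU b) (hk b)
      ((continuousOn_trivialization_snd (D.triv (r b)) subset_rfl).comp hφ.continuousOn
        fun e he => by
          rw [mem_preimage, hpφ]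
          exact D.dom_subset _ (hUdom b _ he))
  choose h hh using hh
  exact ⟨{
    level := j
    Fiber := p' ⁻¹' {x₀}
    Chart := B
    dom := U
    base := W
    isOpen_base := hWo
    exists_mem_base := hWc
    mem_dom := hWU
    dom_nonempty := htriple
    triv := fun b => t (k b)
    dom_subset := hk
    trans := g
    trans_apply := hg }, ⟨{
      level_lt := hlt
      chart := r
      fiberMap := h
      mem_base := hWr
      mem_dom := hUdom
      fiberMap_apply := fun b e he => (hh b e he).symm }⟩⟩

namespace Refinement

variable {D' : Presentation c p'} {D : Presentation c p} {φ : E' → E}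

/-- The map of glued coverings induced by a refinement of presentations. -/
noncomputable def totalMap (R : Refinement D' D φ) (z : D'.Total) : D.Total :=
  ⟨Y.map R.level_lt.le z.1, D.trans (R.chart (D'.core.indexAt z.1))
    (D.core.indexAt (Y.map R.level_lt.le z.1)) (R.fiberMap (D'.core.indexAt z.1) z.2)⟩

/-- The constant maps of the fibres are compatible with the transition functions; this is checked
at a point of `X`. -/
theorem fiberMap_trans (R : Refinement D' D φ) (hpφ : ∀ e, p (φ e) = p' e) {b b' : D'.Chart}
    {y : Y.obj D'.level} (hy : y ∈ D'.base b) (hy' : y ∈ D'.base b') (s : D'.Fiber) :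
    R.fiberMap b' (D'.trans b b' s) = D.trans (R.chart b) (R.chart b') (R.fiberMap b s) := by
  obtain ⟨x, ⟨hx, hx'⟩, -⟩ := D'.dom_nonempty b b' b' ⟨y, ⟨hy, hy'⟩, hy'⟩
  obtain ⟨e, rfl, rfl⟩ := (D'.triv b).exists_proj_eq_and_snd_eq (D'.dom_subset b hx) s
  rw [D'.trans_apply _ _ _ hx hx', R.fiberMap_apply _ _ hx, R.fiberMap_apply _ _ hx',
    D.trans_apply _ _ _ (by rw [hpφ]; exact R.mem_dom _ _ hx)
      (by rw [hpφ]; exact R.mem_dom _ _ hx')]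

theorem continuous_totalMap (R : Refinement D' D φ) (hpφ : ∀ e, p (φ e) = p' e) :
    Continuous R.totalMap := by
  have hproj : Continuous fun z : D'.Total => z.1 := D'.continuous_proj
  have hmap := (Y.continuous_map R.level_lt.le).comp hproj
  refine D.continuous_of_charts hmap fun z b hb => ?_
  have hbz : Y.map R.level_lt.le z.1 ∈ D.base b := hb
  set b' := D'.core.indexAt z.1
  have hz : z.1 ∈ D'.base b' := D'.core.mem_baseSet_at z.1
  -- in the charts `b'` and `b` the map is given by a function of the fibre coordinate
  have key : ∀ w : D'.Total, w.1 ∈ D'.base b' → Y.map R.level_lt.le w.1 ∈ D.base b →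
      D.trans (D.core.indexAt (R.totalMap w).1) b (R.totalMap w).2 =
        D.trans (R.chart b') b (R.fiberMap b' (D'.core.localTriv b' w).2) := by
    intro w hw hwb
    have hw' : w.1 ∈ D'.base (D'.core.indexAt w.1) := D'.core.mem_baseSet_at w.1
    rw [D'.core.localTriv_apply]
    change _ = D.trans _ _ (R.fiberMap b' (D'.trans (D'.core.indexAt w.1) b' w.2))
    have hc := R.mem_base _ _ hw
    have hc' := R.mem_base _ _ hw'
    have h₁ := D.core.coordChange_comp (R.chart (D'.core.indexAt w.1)) (R.chart b') b _
      ⟨⟨hc', hc⟩, hwb⟩ (R.fiberMap (D'.core.indexAt w.1) w.2)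
    have h₂ := D.core.coordChange_comp (R.chart (D'.core.indexAt w.1))
      (D.core.indexAt (Y.map R.level_lt.le w.1)) b _
      ⟨⟨hc', D.core.mem_baseSet_at _⟩, hwb⟩ (R.fiberMap (D'.core.indexAt w.1) w.2)
    exact h₂.trans (h₁.symm.trans
      (congrArg (D.trans (R.chart b') b) (R.fiberMap_trans hpφ hw' hw w.2).symm))
  have hloc : ∀ᶠ w in 𝓝 z, (D'.core.localTriv b' w).2 = (D'.core.localTriv b' z).2 := by
    have hc : ContinuousAt (fun w => (D'.core.localTriv b' w).2) z :=
      (continuousOn_trivialization_snd (D'.core.localTriv b') subset_rfl).continuousAt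
        (((D'.isOpen_base b').preimage hproj).mem_nhds hz)
    exact hc.eventually
      (discreteTopology_iff_forall_isOpen.mp inferInstance {_} |>.mem_nhds rfl)
  filter_upwards [hloc, ((D'.isOpen_base b').preimage hproj).mem_nhds hz,
    ((D.isOpen_base b).preimage hmap).mem_nhds hbz] with w hw₁ hw₂ hw₃
  rw [key w hw₂ hw₃, key z hz hbz, hw₁]

theorem proj_totalMap (R : Refinement D' D φ) (z : D'.Total) :
    D.proj (R.totalMap z) = Y.map R.level_lt.le (D'.proj z) := rfl

theorem totalMap_toTotal (R : Refinement D' D φ) (hpφ : ∀ e, p (φ e) = p' e) (e : E') :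
    R.totalMap (D'.toTotal e) = D.toTotal (φ e) := by
  have hd := D'.mem_dom_indexAt (p' e)
  have hY : Y.map R.level_lt.le (c.app D'.level (p' e)) = c.app D.level (p (φ e)) := by
    rw [c.comm, hpφ]
  unfold totalMap toTotal
  dsimp only
  rw [R.fiberMap_apply _ _ hd, hY]
  congr 1
  exact D.trans_apply _ _ _ (by rw [hpφ]; exact R.mem_dom _ _ hd) (D.mem_dom_indexAt _)

end Refinement

end Presentation

/-! ### Coverings: pull-back, fibrewise bijections, connectedness -/

section Coverings

theorem isCoveringMap_pullback_fst {A B G : Type*} [TopologicalSpace A] [TopologicalSpace B]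
    [TopologicalSpace G] {f : A → B} {q : G → B} (hf : Continuous f) (hq : IsCoveringMap q) :
    IsCoveringMap fun w : {w : A × G // f w.1 = q w.2} => w.1.1 := by
  intro a
  obtain ⟨hd, U, haU, hU, hqU, H, hH⟩ := hq (f a)
  refine IsEvenlyCovered.to_isEvenlyCovered_preimage (I := q ⁻¹' {f a})
    ⟨hd, f ⁻¹' U, haU, hU.preimage hf,
      (hU.preimage hf).preimage (continuous_fst.comp continuous_subtype_val), ?_⟩
  have hmem : ∀ w : {w : A × G // f w.1 = q w.2}, w.1.1 ∈ f ⁻¹' U → w.1.2 ∈ q ⁻¹' U :=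
    fun w hw => by rw [mem_preimage, ← w.2]; exact hw
  have hHs : ∀ v, q (H.symm v) = v.1 := fun v => by rw [← hH, H.apply_symm_apply]
  refine ⟨{
    toFun := fun w => (⟨w.1.1.1, w.2⟩, (H ⟨w.1.1.2, hmem w.1 w.2⟩).2)
    invFun := fun v => ⟨⟨(v.1.1, (H.symm (⟨f v.1.1, v.1.2⟩, v.2)).1), by rw [hHs]⟩, v.1.2⟩
    left_inv := ?_
    right_inv := ?_
    continuous_toFun := by fun_prop
    continuous_invFun := by
      have : Continuous fun v : (f ⁻¹' U) × (q ⁻¹' {f a}) =>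
          ((⟨f v.1.1, v.1.2⟩, v.2) : U × (q ⁻¹' {f a})) := by fun_prop
      fun_prop }, fun _ => rfl⟩
  · rintro ⟨⟨⟨x, z⟩, h⟩, hx⟩
    refine Subtype.ext (Subtype.ext (Prod.ext rfl ?_))
    have : ((⟨f x, hx⟩, (H ⟨z, hmem ⟨(x, z), h⟩ hx⟩).2) : U × (q ⁻¹' {f a})) =
        H ⟨z, hmem ⟨(x, z), h⟩ hx⟩ :=
      Prod.ext (Subtype.ext (by rw [hH]; exact h)) rfl
    change (H.symm (⟨f x, hx⟩, (H ⟨z, hmem ⟨(x, z), h⟩ hx⟩).2)).1 = z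
    rw [this, H.symm_apply_apply]
  · rintro ⟨⟨x, hx⟩, s⟩
    refine Prod.ext rfl ?_
    change (H (H.symm (⟨f x, hx⟩, s))).2 = s
    rw [H.apply_symm_apply]

/-- A continuous bijection over the base between two coverings is a homeomorphism. -/
theorem exists_homeomorph_of_bijective {X E P : Type*} [TopologicalSpace X] [TopologicalSpace E]
    [TopologicalSpace P] {p : E → X} {q : P → X} (hp : IsCoveringMap p) (hq : IsCoveringMap q)
    {θ : E → P} (hθ : Continuous θ) (hqθ : ∀ e, q (θ e) = p e) (hb : Function.Bijective θ) :
    ∃ φ : E ≃ₜ P, ∀ e, φ e = θ e := by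
  have hcomp : q ∘ θ = p := funext hqθ
  have hloc : IsLocalHomeomorph θ :=
    IsLocalHomeomorph.of_comp (hcomp ▸ hp.isLocalHomeomorph) hq.isLocalHomeomorph hθ
  exact ⟨hloc.toHomeomorphOfBijective hb, fun _ => rfl⟩

/-- If the image of a connected space contains a whole fibre of a covering of a connected, locally
connected space, then the total space is connected: each of its components maps onto the base, so
it meets that fibre. -/
theorem connectedSpace_of_fiber_subset_range {E F Y : Type*} [TopologicalSpace E]
    [TopologicalSpace F] [TopologicalSpace Y] [ConnectedSpace E] [ConnectedSpace Y]
    [LocallyConnectedSpace Y] {q : F → Y} (hq : IsCoveringMap q) (hsurj : Function.Surjective q)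
    {θ : E → F} (hθ : Continuous θ) (y₀ : Y) (hfib : ∀ z, q z = y₀ → z ∈ range θ) :
    ConnectedSpace F := by
  obtain ⟨e₀⟩ : Nonempty E := inferInstance
  have : PreconnectedSpace F := by
    refine preconnectedSpace_of_forall_constant fun f hf => ?_
    -- the set of all points over which `f` takes the value `f (θ e₀)` only
    let T : Set Y := {y | ∀ z, q z = y → f z = f (θ e₀)}
    have hloc : ∀ y, ∃ N ∈ 𝓝 y, ∀ y' ∈ N, ∀ y'' ∈ N, y' ∈ T → y'' ∈ T := by
      intro y
      have : Nonempty (q ⁻¹' {y}) := (hsurj y).elim fun z hz => ⟨⟨z, hz⟩⟩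
      let t := (hq y).toTrivialization
      have hy : y ∈ t.baseSet := (hq y).mem_toTrivialization_baseSet
      refine ⟨connectedComponentIn t.baseSet y, t.open_baseSet.connectedComponentIn.mem_nhds
        (mem_connectedComponentIn hy), fun y' hy' y'' hy'' hT z hz => ?_⟩
      have hsub := connectedComponentIn_subset t.baseSet y
      obtain ⟨k, hk⟩ := t.exists_eq_comp_snd (isConnected_connectedComponentIn_iff.mpr hy) hsub
        hf.continuousOn
      obtain ⟨z', hz', hs⟩ := t.exists_proj_eq_and_snd_eq (hsub hy') (t z).2
      rw [hk z (hz ▸ hy''), ← hs, ← hk z' (hz' ▸ hy')]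
      exact hT z' hz'
    have hT : IsClopen T := by
      refine ⟨⟨isOpen_iff_mem_nhds.mpr fun y hy => ?_⟩, isOpen_iff_mem_nhds.mpr fun y hy => ?_⟩ <;>
        obtain ⟨N, hN, h⟩ := hloc y
      · filter_upwards [hN] with y' hy' hT using hy (h y' hy' y (mem_of_mem_nhds hN) hT)
      · filter_upwards [hN] with y' hy' using h y (mem_of_mem_nhds hN) y' hy' hy
    have hTu : T = univ := hT.eq_univ ⟨y₀, fun z hz => by
      obtain ⟨e, rfl⟩ := hfib z hz
      exact PreconnectedSpace.constant inferInstance (hf.comp hθ)⟩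
    have hval : ∀ z, f z = f (θ e₀) := fun z => (hTu ▸ mem_univ (q z) : q z ∈ T) z rfl
    exact fun z z' => (hval z).trans (hval z').symm
  exact ⟨⟨θ e₀⟩⟩

end Coverings

/-! ### Ladders over inverse sequences -/

namespace InverseSequence

section OfSucc

variable {obj : ℕ → Type u} (f : ∀ n, obj (n + 1) → obj n)

/-- The composites of a sequence of successive bonding maps. -/
def compSucc {i j : ℕ} (h : i ≤ j) : obj j → obj i :=
  Nat.leRec (motive := fun j _ => obj j → obj i) id (fun j _ g z => g (f j z)) h

theorem compSucc_self (i : ℕ) (y : obj i) : compSucc f (le_refl i) y = y := by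
  simp [compSucc]

theorem compSucc_succ {i j : ℕ} (h : i ≤ j) (y : obj (j + 1)) :
    compSucc f (h.trans (Nat.le_succ j)) y = compSucc f h (f j y) := by
  unfold compSucc
  rw [Nat.leRec_succ]

/-- The inverse sequence with given successive bonding maps. -/
def ofSucc [∀ n, TopologicalSpace (obj n)] (hf : ∀ n, Continuous (f n)) :
    InverseSequence.{u} where
  obj := obj
  map h := compSucc f h
  continuous_map {i j} h := by
    induction j, h using Nat.le_induction with
    | base => exact continuous_id.congr fun y => (compSucc_self f i y).symm
    | succ j h ih => exact (ih.comp (hf j)).congr fun y => (compSucc_succ f h y).symm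
  map_self := compSucc_self f
  map_map {i j k} h h' := by
    induction k, h' using Nat.le_induction with
    | base => exact fun y => by rw [compSucc_self]
    | succ k h' ih => exact fun y => by rw [compSucc_succ f h', ih, ← compSucc_succ f (h.trans h')]

end OfSucc

end InverseSequence

open InverseSequence

namespace SequenceOver

variable {X : Type u} [TopologicalSpace X] {Y : InverseSequence.{u}}

theorem Homeomorphic.trans {E F G : SequenceOver Y} (h : E.Homeomorphic F)
    (h' : F.Homeomorphic G) : E.Homeomorphic G := by
  obtain ⟨φ, hφ, hφ'⟩ := h
  obtain ⟨ψ, hψ, hψ'⟩ := h'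
  refine ⟨fun i => (φ i).trans (ψ i), fun i z => ?_, fun i j hij z => ?_⟩
  · exact (hψ i _).trans (hφ i z)
  · exact (congrArg (ψ i) (hφ' i j hij z)).trans (hψ' i j hij _)

theorem Homeomorphic.pullback {F G : SequenceOver Y} (h : F.Homeomorphic G) (c : Cone X Y) :
    (F.pullback c).Homeomorphic (G.pullback c) := by
  obtain ⟨φ, hφ, hφ'⟩ := h
  refine ⟨fun i => ((Homeomorph.refl X).prodCongr (φ i)).subtype fun w => ?_, fun _ _ => rfl,
    fun i j hij z => Subtype.ext (Prod.ext rfl (hφ' i j hij _))⟩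
  change _ ↔ c.app i w.1 = G.proj i (φ i w.2)
  rw [hφ]

/-- The ladder over a constant sequence `X`, with the identity covering of `X` put in front. -/
def augment (E : SequenceOver (const X)) : SequenceOver (const X) where
  total :=
    { obj := fun n => match n with
        | 0 => X
        | n + 1 => E.total.obj n
      top := fun n => match n with
        | 0 => inferInstanceAs (TopologicalSpace X)
        | n + 1 => E.total.top n
      map := fun {i j} h => match i, j, h with
        | 0, 0, _ => id
        | 0, j + 1, _ => E.proj j
        | _ + 1, _ + 1, h => E.total.map (Nat.le_of_succ_le_succ h)
      continuous_map := fun {i j} h => match i, j, h with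
        | 0, 0, _ => continuous_id
        | 0, j + 1, _ => E.continuous_proj j
        | _ + 1, _ + 1, _ => E.total.continuous_map _
      map_self := fun i => match i with
        | 0 => fun _ => rfl
        | i + 1 => E.total.map_self i
      map_map := fun {i j k} h h' => match i, j, k, h, h' with
        | 0, 0, 0, _, _ => fun _ => rfl
        | 0, 0, _ + 1, _, _ => fun _ => rfl
        | 0, _ + 1, _ + 1, _, h' => fun y => (E.comm (Nat.le_of_succ_le_succ h') y).symm
        | _ + 1, _ + 1, _ + 1, _, _ => E.total.map_map _ _ }
  proj := fun n => match n with
    | 0 => id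
    | n + 1 => E.proj n
  continuous_proj := fun n => match n with
    | 0 => continuous_id
    | n + 1 => E.continuous_proj n
  comm := fun {i j} h => match i, j, h with
    | 0, 0, _ => fun _ => rfl
    | 0, _ + 1, _ => fun _ => rfl
    | _ + 1, _ + 1, h => E.comm (Nat.le_of_succ_le_succ h)

theorem IsCovering.augment {E : SequenceOver (const X)} (hE : E.IsCovering) :
    E.augment.IsCovering := fun n => match n with
  | 0 => ⟨IsFiberBundle.isCoveringMap fun x => ⟨idTrivialization.{u} X, mem_univ x⟩, Function.surjective_id⟩
  | n + 1 => hE n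

/-- Coverings over an increasing sequence of terms of `Y` that carry successive bonding maps. -/
def ofSucc {m : ℕ → ℕ} (hm : StrictMono m) (G : ℕ → Type u) [∀ n, TopologicalSpace (G n)]
    (q : ∀ n, G n → Y.obj (m n)) (hq : ∀ n, Continuous (q n)) (f : ∀ n, G (n + 1) → G n)
    (hf : ∀ n, Continuous (f n))
    (hqf : ∀ n z, q n (f n z) = Y.map (hm.monotone (Nat.le_succ n)) (q (n + 1) z)) :
    SequenceOver (Y.subsequence m hm) where
  total := InverseSequence.ofSucc f hf
  proj := q
  continuous_proj := hq
  comm {i j} h := by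
    change ∀ z : G j, Y.map (hm.monotone h) (q j z) = q i (compSucc f h z)
    induction j, h using Nat.le_induction with
    | base => exact fun z => by rw [Y.map_self, compSucc_self]
    | succ j h ih => exact fun z => by rw [compSucc_succ f h, ← ih, hqf, Y.map_map]

/-- A ladder over a subsequence, extended to all terms: over the term `Y.obj i` stands the pull-back
of the covering of the earlier term `Y.obj (m (k i))`. -/
def fill {m : ℕ → ℕ} {hm : StrictMono m} (G : SequenceOver (Y.subsequence m hm)) {k : ℕ → ℕ}
    (hk : Monotone k) (hmk : ∀ i, m (k i) ≤ i) : SequenceOver Y where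
  total :=
    { obj := fun i => {w : Y.obj i × G.total.obj (k i) // Y.map (hmk i) w.1 = G.proj (k i) w.2}
      map := fun {i j} h w => ⟨(Y.map h w.1.1, G.total.map (hk h) w.1.2), by
        rw [← G.comm (hk h), ← w.2]
        exact (Y.map_map _ _ _).trans (Y.map_map _ _ _).symm⟩
      continuous_map := fun h => by
        have := G.total.continuous_map (hk h)
        have := Y.continuous_map h
        exact Continuous.subtype_mk (by fun_prop) _
      map_self := fun i w =>
        Subtype.ext (Prod.ext (Y.map_self i _) (G.total.map_self (k i) _))
      map_map := fun h h' w =>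
        Subtype.ext (Prod.ext (Y.map_map h h' _) (G.total.map_map (hk h) (hk h') _)) }
  proj _ w := w.1.1
  continuous_proj _ := continuous_fst.comp continuous_subtype_val
  comm _ _ := rfl

section Fill

variable {m : ℕ → ℕ} {hm : StrictMono m} {G : SequenceOver (Y.subsequence m hm)} {k : ℕ → ℕ}
  (hk : Monotone k) (hmk : ∀ i, m (k i) ≤ i)

theorem IsCovering.fill (hG : G.IsCovering) : (G.fill hk hmk).IsCovering := fun i =>
  ⟨isCoveringMap_pullback_fst (f := Y.map (hmk i)) (q := G.proj (k i)) (Y.continuous_map (hmk i))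
    (hG (k i)).1, fun y => by
      obtain ⟨z, hz⟩ := (hG (k i)).2 (Y.map (hmk i) y)
      exact ⟨⟨(y, z), hz.symm⟩, rfl⟩⟩

theorem homeomorphic_fill_subsequence (hkm : ∀ n, k (m n) = n) :
    G.Homeomorphic ((G.fill hk hmk).subsequence m hm) := by
  refine ⟨fun n => {
    toFun := fun z => ⟨(G.proj n z, G.total.map (hkm n).le z), G.comm (hkm n).le z⟩
    invFun := fun w => G.total.map (hkm n).ge w.1.2
    left_inv := fun z => (G.total.map_map _ _ z).trans (G.total.map_self n z)
    right_inv := fun w => Subtype.ext (Prod.ext ?_ ?_)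
    continuous_toFun :=
      ((G.continuous_proj n).prodMk (G.total.continuous_map _)).subtype_mk _
    continuous_invFun :=
      (G.total.continuous_map _).comp (continuous_snd.comp continuous_subtype_val) },
    fun _ _ => rfl, fun i j h z => Subtype.ext (Prod.ext (G.comm h z).symm ?_)⟩
  · change G.proj n (G.total.map (hkm n).ge w.1.2) = w.1.1
    rw [← G.comm, ← w.2]
    exact (Y.map_map _ _ _).trans (Y.map_self _ _)
  · exact (G.total.map_map _ _ _).trans (G.total.map_self _ _)
  · exact (G.total.map_map _ _ _).trans (G.total.map_map _ _ _).symm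

end Fill

/-- Levelwise coordinates for a ladder over `X` that is the pull-back of part of a ladder `F`: the
maps `β` to the levels of `F`, and the maps `σ` from the fibre products. -/
theorem Homeomorphic.exists_coordinates {c : Cone X Y} {F : SequenceOver Y}
    {E : SequenceOver (const X)} {m : ℕ → ℕ} {hm : StrictMono m}
    (h : E.Homeomorphic ((F.subsequence m hm).pullback (c.subsequence m hm))) :
    ∃ (β : ∀ n, E.total.obj n → F.total.obj (m n))
      (σ : ∀ n, {w : X × F.total.obj (m n) // c.app (m n) w.1 = F.proj (m n) w.2} →
        E.total.obj n),
      (∀ n, Continuous (β n)) ∧ (∀ n, Continuous (σ n)) ∧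
      (∀ n e, F.proj (m n) (β n e) = c.app (m n) (E.proj n e)) ∧
      (∀ i j (h : i ≤ j) e, β i (E.total.map h e) = F.total.map (hm.monotone h) (β j e)) ∧
      (∀ n w, E.proj n (σ n w) = w.1.1) ∧ (∀ n w, β n (σ n w) = w.1.2) ∧
      (∀ n e e', (E.proj n e : X) = E.proj n e' → β n e = β n e' → e = e') := by
  obtain ⟨φ, hφ, hφ'⟩ := h
  refine ⟨fun n e => (φ n e).1.2, fun n => (φ n).symm,
    fun n => (continuous_snd.comp continuous_subtype_val :
      Continuous fun w : {w : X × F.total.obj (m n) // c.app (m n) w.1 = F.proj (m n) w.2} =>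
        w.1.2).comp (φ n).continuous,
    fun n => (φ n).symm.continuous, fun n e => ?_, fun i j h e => ?_, fun n w => ?_,
    fun n w => ?_, fun n e e' h₁ h₂ => ?_⟩
  · exact (φ n e).2.symm.trans (congrArg (c.app (m n)) (hφ n e))
  · exact congrArg (fun w => w.1.2) (hφ' i j h e)
  · refine (hφ n _).symm.trans (congrArg (fun w => w.1.1) ((φ n).apply_symm_apply w))
  · exact congrArg (fun w => w.1.2) ((φ n).apply_symm_apply w)
  · exact (φ n).injective (Subtype.ext (Prod.ext ((hφ n e).trans (h₁.trans (hφ n e').symm)) h₂))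

/-- A ladder over a sequence with limit `X` and its pull-back to `X` have the same limit; for the
pull-back, a subsequence suffices. -/
theorem exists_limit_homeomorph {c : Cone X Y} (hc : c.IsLimit) {F : SequenceOver Y}
    {E : SequenceOver (const X)} {m : ℕ → ℕ} {hm : StrictMono m}
    (h : E.Homeomorphic ((F.subsequence m hm).pullback (c.subsequence m hm))) :
    ∃ Ψ : E.total.limit ≃ₜ F.total.limit,
      ∀ z, F.limitProj (Ψ z) = c.toLimit (E.limitProjConst z) := by
  obtain ⟨β, σ, hβc, hσc, hβ, hβm, hσp, hσβ, hinj⟩ := h.exists_coordinates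
  have hmi : ∀ i, i ≤ m i := fun i => hm.le_apply
  let L : X ≃ₜ Y.limit := hc.homeomorph
  have hproj : ∀ (z : E.total.limit) n, E.proj n (z.1 n) = E.limitProjConst z := fun z n =>
    (E.comm (Nat.zero_le n) (z.1 n)).trans (congrArg (E.proj 0) (z.2 0 n (Nat.zero_le n)))
  have hβz : ∀ (z : E.total.limit) i j (h : i ≤ j),
      F.total.map (hm.monotone h) (β j (z.1 j)) = β i (z.1 i) := fun z i j h =>
    (hβm i j h _).symm.trans (congrArg (β i) (z.2 i j h))
  let f : E.total.limit → F.total.limit := fun z =>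
    ⟨fun i => F.total.map (hmi i) (β i (z.1 i)), fun i j h =>
      (F.total.map_map h (hmi j) _).trans
        ((F.total.map_map (hmi i) (hm.monotone h) _).symm.trans
          (congrArg (F.total.map (hmi i)) (hβz z i j h)))⟩
  have hf : ∀ z, F.limitProj (f z) = c.toLimit (E.limitProjConst z) := fun z =>
    Subtype.ext (funext fun i => calc
      F.proj i (F.total.map (hmi i) (β i (z.1 i)))
        = Y.map (hmi i) (F.proj (m i) (β i (z.1 i))) := (F.comm (hmi i) _).symm
      _ = Y.map (hmi i) (c.app (m i) (E.limitProjConst z)) :=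
          congrArg (Y.map (hmi i)) ((hβ i _).trans (congrArg (c.app (m i)) (hproj z i)))
      _ = c.app i (E.limitProjConst z) := c.comm (hmi i) _)
  -- the point of `X` under a thread of `F`
  let pt : F.total.limit → X := fun w => L.symm (F.limitProj w)
  have hpt : ∀ w i, c.app i (pt w) = F.proj i (w.1 i) := fun w i =>
    congrFun (congrArg Subtype.val (L.apply_symm_apply (F.limitProj w))) i
  let g : F.total.limit → E.total.limit := fun w =>
    ⟨fun n => σ n ⟨(pt w, w.1 (m n)), hpt w (m n)⟩, fun i j h => hinj i _ _
      ((E.comm h _).symm.trans ((hσp j _).trans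
        (hσp i ⟨(pt w, w.1 (m i)), hpt w (m i)⟩).symm))
      ((hβm i j h _).trans ((congrArg (F.total.map (hm.monotone h)) (hσβ j _)).trans
        ((w.2 _ _ (hm.monotone h)).trans (hσβ i ⟨(pt w, w.1 (m i)), hpt w (m i)⟩).symm)))⟩
  have hgf : Function.LeftInverse g f := fun z =>
    Subtype.ext (funext fun n => hinj n _ _
      ((hσp n _).trans ((congrArg L.symm (hf z)).trans
        ((L.symm_apply_apply (E.limitProjConst z)).trans (hproj z n).symm)))
      ((hσβ n _).trans (hβz z n (m n) (hmi n))))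
  have hfg : Function.RightInverse g f := fun w =>
    Subtype.ext (funext fun i =>
      (congrArg (F.total.map (hmi i)) (hσβ i _)).trans (w.2 _ _ (hmi i)))
  have hcoord : ∀ (Z : InverseSequence.{u}) i, Continuous fun w : Z.limit => w.1 i := fun Z i =>
    (continuous_apply i).comp continuous_subtype_val
  have hptc : Continuous pt := L.symm.continuous.comp
    ((continuous_pi fun i => (F.continuous_proj i).comp (hcoord _ i)).subtype_mk _)
  refine ⟨⟨⟨f, g, hgf, hfg⟩, ?_, ?_⟩, hf⟩
  · exact (continuous_pi fun i => (F.total.continuous_map (hmi i)).comp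
      ((hβc i).comp (hcoord _ i))).subtype_mk _
  · exact (continuous_pi fun n => (hσc n).comp
      ((hptc.prodMk (hcoord _ (m n))).subtype_mk fun w => hpt w (m n))).subtype_mk _

end SequenceOver

/-! ### Descent of a sequence of coverings -/

open Presentation in
/-- A sequence of coverings of the limit is the pull-back of a sequence of coverings over a
subsequence of the expansion, starting from any presentation of the initial covering. -/
theorem Cone.IsLimit.exists_descent {X : Type u} [TopologicalSpace X] {Y : InverseSequence.{u}}
    {c : Cone X Y} [CompactSpace X] [ConnectedSpace X] [LocallyConnectedSpace X]
    [TopologicalSpace.MetrizableSpace X] [∀ i, CompactSpace (Y.obj i)] [∀ i, T2Space (Y.obj i)]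
    (hc : c.IsLimit) {E : SequenceOver (const X)} (hE : E.IsCovering)
    (D₀ : Presentation (X := X) c (E.proj 0)) :
    ∃ (m : ℕ → ℕ) (hm : StrictMono m) (G : SequenceOver (Y.subsequence m hm)),
      m 0 = D₀.level ∧ G.IsCovering ∧
        E.Homeomorphic (G.pullback (c.subsequence m hm)) := by
  have hφ : ∀ n e, E.proj n (E.total.map (Nat.le_succ n) e) = E.proj (n + 1) e := fun n e =>
    (E.comm (Nat.le_succ n) e).symm
  have hnext : ∀ n (D : Presentation (X := X) c (E.proj n)),
      ∃ D' : Presentation (X := X) c (E.proj (n + 1)),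
        Nonempty (Refinement D' D (E.total.map (Nat.le_succ n))) := fun n D =>
    D.exists_refinement hc (hE (n + 1)).1 (hE (n + 1)).2 (E.total.continuous_map _) (hφ n)
  choose next hnext using hnext
  let D : ∀ n, Presentation (X := X) c (E.proj n) := fun n => Nat.rec D₀ (fun n D => next n D) n
  have R : ∀ n, Refinement (D (n + 1)) (D n) (E.total.map (Nat.le_succ n)) := fun n =>
    (hnext n (D n)).some
  have hm : StrictMono fun n => (D n).level := strictMono_nat_of_lt_succ fun n => (R n).level_lt
  let G : SequenceOver (Y.subsequence _ hm) :=
    SequenceOver.ofSucc hm (fun n => (D n).Total) (fun n => (D n).proj)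
      (fun n => (D n).continuous_proj) (fun n => (R n).totalMap)
      (fun n => (R n).continuous_totalMap (hφ n)) (fun n => (R n).proj_totalMap)
  have hG : G.IsCovering := fun n => ⟨(D n).isCoveringMap_proj, (D n).surjective_proj (hE n).2⟩
  refine ⟨_, hm, G, rfl, hG, ?_⟩
  let f : ∀ n, (D (n + 1)).Total → (D n).Total := fun n => (R n).totalMap
  have hcomm : ∀ {i j} (h : i ≤ j) e, (D i).toTotal (E.total.map h e) =
      compSucc (obj := fun n => (D n).Total) f h ((D j).toTotal e) := by
    intro i j h
    induction j, h using Nat.le_induction with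
    | base =>
      exact fun e => (congrArg (D i).toTotal (E.total.map_self i e)).trans
        (compSucc_self (obj := fun n => (D n).Total) f i _).symm
    | succ j h ih =>
      exact fun e => (congrArg (D i).toTotal (E.total.map_map h (Nat.le_succ j) e).symm).trans
        ((ih _).trans ((congrArg (compSucc (obj := fun n => (D n).Total) f h)
          ((R j).totalMap_toTotal (hφ j) e).symm).trans
            (compSucc_succ (obj := fun n => (D n).Total) f h _).symm))
  have hhom : ∀ n, ∃ φ : E.total.obj n ≃ₜ (G.pullback (c.subsequence _ hm)).total.obj n,
      ∀ e, φ e = ⟨(E.proj n e, (D n).toTotal e), rfl⟩ := by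
    intro n
    refine exists_homeomorph_of_bijective (hE n).1
      (isCoveringMap_pullback_fst (f := c.app (D n).level) (q := (D n).proj)
        (c.continuous_app _) (hG n).1)
      (θ := fun e => ⟨(E.proj n e, (D n).toTotal e), rfl⟩)
      (((E.continuous_proj n).prodMk
        ((D n).continuous_toTotal (E.continuous_proj n))).subtype_mk _) (fun _ => rfl) ⟨?_, ?_⟩
    · intro e e' h
      have h' := congrArg Subtype.val h
      have h₁ : E.proj n e = E.proj n e' := congrArg Prod.fst h'
      have h₂ : (D n).toTotal e = (D n).toTotal e' := congrArg Prod.snd h'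
      exact ((D n).existsUnique_toTotal_eq (E.proj n e') ((D n).toTotal e') rfl).unique
        ⟨h₁, h₂⟩ ⟨rfl, rfl⟩
    · rintro ⟨⟨x, z⟩, h⟩
      obtain ⟨e, he, he'⟩ := ((D n).existsUnique_toTotal_eq x z h).exists
      exact ⟨e, Subtype.ext (Prod.ext he he')⟩
  choose φ hφ' using hhom
  refine ⟨φ, fun n e => by rw [hφ']; rfl, fun i j h e => ?_⟩
  rw [hφ', hφ']
  exact Subtype.ext (Prod.ext (E.comm h e).symm (hcomm h e))

/-- The witness `k i` is the last index `n` with `m n ≤ i`. -/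
theorem exists_monotone_section {m : ℕ → ℕ} (hm : StrictMono m) (hm₀ : m 0 = 0) :
    ∃ k : ℕ → ℕ, Monotone k ∧ (∀ i, m (k i) ≤ i) ∧ ∀ n, k (m n) = n := by
  have hle : ∀ i, m (Nat.findGreatest (fun n => m n ≤ i) i) ≤ i := fun i =>
    Nat.findGreatest_spec (P := fun n => m n ≤ i) (Nat.zero_le i) (hm₀.trans_le (Nat.zero_le i))
  refine ⟨fun i => Nat.findGreatest (fun n => m n ≤ i) i,
    fun i j h => Nat.findGreatest_mono (fun n hn => le_trans hn h) h, hle, fun n =>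
      le_antisymm (hm.le_iff_le.mp (hle (m n))) (Nat.le_findGreatest hm.le_apply le_rfl)⟩

end InverseLimitCoverings

theorem theorem3 {X : Type u} [TopologicalSpace X] (hX : IsPeanoContinuum X)
    (P : PolyhedralExpansion X)
    (E : SequenceOver (InverseSequence.const X)) (hE : E.IsCovering) :
    ∃ F : SequenceOver P.seq,
      F.IsCovering ∧
      ((∀ n, ConnectedSpace (E.total.obj n)) →
        ∀ i, ConnectedSpace (P.seq.obj i) → ConnectedSpace (F.total.obj i)) ∧
      (∃ (m : ℕ → ℕ) (hm : StrictMono m),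
        E.Homeomorphic ((F.subsequence m hm).pullback (P.cone.subsequence m hm))) ∧
      (∃ Ψ : E.total.limit ≃ₜ F.total.limit,
        ∀ z, F.limitProj (Ψ z) = P.cone.toLimit (E.limitProjConst z)) := by
  obtain ⟨hXc, hXconn, hXlc, hXm⟩ := hX
  have hcomp : ∀ i, CompactSpace (P.seq.obj i) := fun i => (P.polyhedron i).compactSpace
  have hT2 : ∀ i, T2Space (P.seq.obj i) := fun i => (P.polyhedron i).t2Space
  obtain ⟨x₀⟩ : Nonempty X := inferInstance
  obtain ⟨m, hm, G, hm₀, hG, hEG⟩ := P.isLimit.exists_descent hE.augment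
    (Presentation.initial P.cone)
  obtain ⟨k, hk, hmk, hkm⟩ := exists_monotone_section hm hm₀
  have hF := hG.fill hk hmk
  have hEF := hEG.trans
    ((SequenceOver.homeomorphic_fill_subsequence hk hmk hkm).pullback (P.cone.subsequence m hm))
  have hm' : StrictMono fun n => m (n + 1) := fun i j h => hm (Nat.succ_lt_succ h)
  -- forget the identity covering of `X` in front
  have hEF' : E.Homeomorphic (((G.fill hk hmk).subsequence _ hm').pullback
      (P.cone.subsequence _ hm')) := by
    obtain ⟨φ, hφ, hφ'⟩ := hEF
    exact ⟨fun n => φ (n + 1), fun n => hφ (n + 1),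
      fun i j h => hφ' (i + 1) (j + 1) (Nat.succ_le_succ h)⟩
  refine ⟨G.fill hk hmk, hF, fun hconn i hi => ?_, ⟨_, hm', hEF'⟩,
    SequenceOver.exists_limit_homeomorph P.isLimit hEF'⟩
  have hconn' : ∀ n, ConnectedSpace (E.augment.total.obj n) := fun n => match n with
    | 0 => hXconn
    | n + 1 => hconn n
  have hlc := (P.polyhedron i).locallyConnectedSpace
  have := hconn' (k i)
  obtain ⟨φ, hφ, -⟩ := hEG
  -- the map `(π i, G (k i))` from the connected pull-back of `G (k i)` to `X`
  refine connectedSpace_of_fiber_subset_range (E := E.augment.total.obj (k i)) (hF i).1 (hF i).2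
    (θ := fun e => ⟨(P.cone.app i (φ (k i) e).1.1, (φ (k i) e).1.2),
      (P.cone.comm (hmk i) _).trans (φ (k i) e).2⟩) ?_ (P.cone.app i x₀) ?_
  · have h₁ := continuous_subtype_val.comp (φ (k i)).continuous
    exact (((P.cone.continuous_app i).comp (continuous_fst.comp h₁)).prodMk
      (continuous_snd.comp h₁)).subtype_mk _
  · rintro ⟨⟨y, z⟩, h⟩ rfl
    refine ⟨(φ (k i)).symm ⟨(x₀, z), (P.cone.comm (hmk i) x₀).symm.trans h⟩, ?_⟩
    exact Subtype.ext (congrArg (fun w => (P.cone.app i w.1.1, w.1.2))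
      ((φ (k i)).apply_symm_apply ⟨(x₀, z), (P.cone.comm (hmk i) x₀).symm.trans h⟩))
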